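/- Let $(M,\omega)$ be a symplectic manifold (without boundary) of dimension $2n$, and let $N\subseteq M$ be a closed (i.e., compact and without boundary) coisotropic submanifold of codimension $k$, which means that for every $x\in N$ the symplectic complement $T_xN^{\omega}=\{v\in T_xM \mid \omega(v,w)=0\ \text{for all } w\in T_xN\}$ is contained in $T_xN$. Put $m:=n-k$, and equip $M\times M$ with the symplectic form $\omega\oplus(-\omega)=\mathrm{pr}_1^*\omega-\mathrm{pr}_2^*\omega$. Then there exists a symplectic submanifold (without boundary) $\widetilde M$ of $M\times M$ of dimension $2n+2m$ that is contained in $M\times N$ and contains the diagonal $\widetilde N:=\{(x,x)\mid x\in N\}$. Moreover, for every symplectic submanifold $\widetilde M$ of $M\times M$ of dimension $2n+2m$ with $\widetilde N\subseteq\widetilde M\subseteq M\times N$, the set $\widetilde N$ is a Lagrangian submanifold of $\widetilde M$. -/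

import Mathlib

open scoped Manifold ContDiff Topology

noncomputable section

namespace Sympl

section Defs

variable {E : Type*} [NormedAddCommGroup E] [NormedSpace ℝ E]
  {H : Type*} [TopologicalSpace H] (I : ModelWithCorners ℝ E H)
  (M : Type*) [TopologicalSpace M] [ChartedSpace H M]

/-- A field of alternating bilinear forms on the tangent spaces of `M`
(a 2-form on which no regularity is imposed yet). -/
abbrev TwoForm : Type _ := ∀ x : M, (TangentSpace I x) [⋀^Fin 2]→L[ℝ] ℝ

variable {M}

/-- The coordinate representation of `Ω` in the preferred chart around `x₀`, i.e. the pullback of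
`Ω` under the inverse of this chart. Only its values on the target of the chart matter. -/
def TwoForm.inChart (Ω : TwoForm I M) (x₀ : M) : E → E [⋀^Fin 2]→L[ℝ] ℝ := fun y =>
  (Ω ((extChartAt I x₀).symm y)).compContinuousLinearMap
    (mfderiv 𝓘(ℝ, E) I (extChartAt I x₀).symm y)

/-- `Ω` is a symplectic form on the manifold without boundary `M`: it is smooth, closed and
nondegenerate. -/
structure IsSymplecticForm (Ω : TwoForm I M) : Prop where
  smooth : ∀ x₀ : M, ContDiffOn ℝ ∞ (TwoForm.inChart I Ω x₀) (extChartAt I x₀).target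
  closed : ∀ x₀ : M, ∀ y ∈ (extChartAt I x₀).target, extDeriv (TwoForm.inChart I Ω x₀) y = 0
  nondegenerate : ∀ (x : M) (v : TangentSpace I x),
    (∀ w : TangentSpace I x, Ω x ![v, w] = 0) → v = 0

/-- `S` is a (smooth, embedded) submanifold without boundary of dimension `d` of the manifold
without boundary `M`: around each point of `S` there is a smooth chart of `M` in which `S` is
given by a linear subspace of dimension `d`. -/
def IsSubmanifold (d : ℕ) (S : Set M) : Prop :=
  ∀ p ∈ S, ∃ e ∈ IsManifold.maximalAtlas I ∞ M, p ∈ e.source ∧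
    ∃ W : Submodule ℝ E, Module.finrank ℝ W = d ∧ ∀ q ∈ e.source, (q ∈ S ↔ e.extend I q ∈ W)

/-- The tangent space `T_p S ⊆ T_p M` of a submanifold `S` of `M` at a point `p` of `S`: the set
of the velocities at time `0` of the smooth curves in `S` that pass through `p` at time `0`. -/
def tangentTo (S : Set M) (p : M) : Set (TangentSpace I p) :=
  {v | ∃ γ : ℝ → M, γ 0 = p ∧ (∀ᶠ t in 𝓝 (0 : ℝ), γ t ∈ S) ∧ ContMDiffAt 𝓘(ℝ, ℝ) I ∞ γ 0 ∧
    (mfderiv 𝓘(ℝ, ℝ) I γ 0 (1 : ℝ) : E) = v}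

/-- `S` is a coisotropic submanifold of dimension `d` of `(M, Ω)`: for every `p ∈ S` the
symplectic complement of `T_p S` is contained in `T_p S`. -/
def IsCoisotropicSubmanifold (Ω : TwoForm I M) (d : ℕ) (S : Set M) : Prop :=
  IsSubmanifold I d S ∧ ∀ p ∈ S, ∀ v : TangentSpace I p,
    (∀ w ∈ tangentTo I S p, Ω p ![v, w] = 0) → v ∈ tangentTo I S p

/-- `S` is a symplectic submanifold of dimension `d` of `(M, Ω)`: for every `p ∈ S` the
restriction of `Ω` to `T_p S` is nondegenerate. -/
def IsSymplecticSubmanifold (Ω : TwoForm I M) (d : ℕ) (S : Set M) : Prop :=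
  IsSubmanifold I d S ∧ ∀ p ∈ S, ∀ v ∈ tangentTo I S p,
    (∀ w ∈ tangentTo I S p, Ω p ![v, w] = 0) → v = 0

/-- `L` is a Lagrangian submanifold of the `d`-dimensional symplectic submanifold `P` of `(M, Ω)`:
it is a submanifold that is contained in `P`, its dimension is half of that of `P`, and `Ω`
vanishes on its tangent spaces. (As `P` is embedded in `M`, the submanifolds of `P` are those
submanifolds of `M` that are contained in `P`.) -/
def IsLagrangianSubmanifoldOf (Ω : TwoForm I M) (d : ℕ) (P L : Set M) : Prop :=
  IsSymplecticSubmanifold I Ω d P ∧ L ⊆ P ∧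
    (∃ l : ℕ, 2 * l = d ∧ IsSubmanifold I l L) ∧
    ∀ p ∈ L, ∀ v ∈ tangentTo I L p, ∀ w ∈ tangentTo I L p, Ω p ![v, w] = 0

/-- The 2-form `Ω ⊕ (-Ω) = pr₁^* Ω - pr₂^* Ω` on `M × M`. -/
def TwoForm.prodNeg (Ω : TwoForm I M) : TwoForm (I.prod I) (M × M) := fun p =>
  (Ω p.1).compContinuousLinearMap (mfderiv (I.prod I) I (Prod.fst : M × M → M) p) -
    (Ω p.2).compContinuousLinearMap (mfderiv (I.prod I) I (Prod.snd : M × M → M) p)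

end Defs

/-- The diagonal embedding `{(x, x) | x ∈ N}` of `N` in `M × M`. -/
def diagonalOf {M : Type*} (N : Set M) : Set (M × M) := {p | ∃ x ∈ N, p = (x, x)}

end Sympl

end

noncomputable section

namespace Sympl

theorem exists_straightening {V Y : Type*} [NormedAddCommGroup V] [NormedSpace ℝ V]
    [FiniteDimensional ℝ V] [NormedAddCommGroup Y] [NormedSpace ℝ Y] [FiniteDimensional ℝ Y]
    {Φ : V → Y} {O : Set V} (hO : IsOpen O) (hΦ : ContDiffOn ℝ ∞ Φ O) {p : V} (hp : p ∈ O)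
    (hs : Function.Surjective (fderiv ℝ Φ p)) :
    ∃ ψ : OpenPartialHomeomorph V V, p ∈ ψ.source ∧ ψ.source ⊆ O ∧
      ContDiffOn ℝ ∞ ψ ψ.source ∧ ContDiffOn ℝ ∞ ψ.symm ψ.target ∧
      HasFDerivAt ψ (ContinuousLinearMap.id ℝ V) p ∧
      ∀ q ∈ ψ.source, (Φ q = 0 ↔ ψ q ∈ LinearMap.ker (fderiv ℝ Φ p).toLinearMap) := by
  obtain ⟨S', hS'⟩ := (fderiv ℝ Φ p).toLinearMap.exists_rightInverse_of_surjective
    (LinearMap.range_eq_top.2 hs)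
  set A := fderiv ℝ Φ p with hA
  let S : Y →L[ℝ] V := LinearMap.toContinuousLinearMap S'
  have hAS : ∀ y, A (S y) = y := fun y => LinearMap.congr_fun hS' y
  let g : V → V := fun q => q + S (Φ q - A q)
  have hgO : ContDiffOn ℝ ∞ g O :=
    contDiffOn_id.add (S.contDiff.comp_contDiffOn (hΦ.sub A.contDiff.contDiffOn))
  have hΦd : ∀ q ∈ O, HasFDerivAt Φ (fderiv ℝ Φ q) q := fun q hq =>
    ((hΦ.contDiffAt (hO.mem_nhds hq)).differentiableAt (by simp)).hasFDerivAt
  have hgd : ∀ q ∈ O, HasFDerivAt g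
      (ContinuousLinearMap.id ℝ V + S.comp (fderiv ℝ Φ q - A)) q := fun q hq =>
    (hasFDerivAt_id q).add (S.hasFDerivAt.comp q ((hΦd q hq).sub A.hasFDerivAt))
  have hgp : HasFDerivAt g ((ContinuousLinearEquiv.refl ℝ V : V ≃L[ℝ] V) : V →L[ℝ] V) p := by
    convert hgd p hp using 1
    ext v; simp [hA]
  have hga : ContDiffAt ℝ ∞ g p := hgO.contDiffAt (hO.mem_nhds hp)
  let ψ₀ := hga.toOpenPartialHomeomorph g hgp (by simp)
  have hψ₀ : ∀ q, ψ₀ q = g q := fun q => rfl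
  have hcont : ContinuousOn (fderiv ℝ g) O :=
    hgO.continuousOn_fderiv_of_isOpen hO (by simp)
  let O' : Set V := O ∩ fderiv ℝ g ⁻¹' (Set.range ((↑) : (V ≃L[ℝ] V) → V →L[ℝ] V))
  have hO' : IsOpen O' := hcont.isOpen_inter_preimage hO ContinuousLinearEquiv.isOpen
  have hpO' : p ∈ O' := ⟨hp, ⟨_, hgp.fderiv.symm⟩⟩
  refine ⟨ψ₀.restrOpen O' hO', ?_, ?_, ?_, ?_, ?_, ?_⟩
  · exact ⟨hga.mem_toOpenPartialHomeomorph_source hgp (by simp), hpO'⟩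
  · exact fun q hq => hq.2.1
  · exact hgO.mono fun q hq => hq.2.1
  · intro y hy
    have hq := (ψ₀.restrOpen O' hO').map_target hy
    obtain ⟨L, hL⟩ := hq.2.2
    refine (OpenPartialHomeomorph.contDiffAt_symm (f₀' := L) (ψ₀.restrOpen O' hO') hy ?_
      (hgO.contDiffAt (hO.mem_nhds hq.2.1))).contDiffWithinAt
    rw [hL]
    exact ((hgO.contDiffAt (hO.mem_nhds hq.2.1)).differentiableAt (by simp)).hasFDerivAt
  · exact hgp
  · intro q _
    have hval : (ψ₀.restrOpen O' hO') q = g q := rfl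
    rw [hval, LinearMap.mem_ker]
    change Φ q = 0 ↔ A (q + S (Φ q - A q)) = 0
    rw [map_add, hAS, add_sub_cancel]

section Charts

variable {E : Type*} [NormedAddCommGroup E] [NormedSpace ℝ E]
  {H : Type*} [TopologicalSpace H] {I : ModelWithCorners ℝ E H}
  {M : Type*} [TopologicalSpace M] [ChartedSpace H M]

theorem mdifferentiableAt_extend {e : OpenPartialHomeomorph M H}
    (he : e ∈ IsManifold.maximalAtlas I ∞ M) {p : M} (hp : p ∈ e.source) :
    MDifferentiableAt I 𝓘(ℝ, E) (e.extend I) p :=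
  (e.contMDiffAt_extend he hp).mdifferentiableAt (by simp)

variable [I.Boundaryless]

theorem contMDiffAt_extend_symm {e : OpenPartialHomeomorph M H}
    (he : e ∈ IsManifold.maximalAtlas I ∞ M) {u : E} (hu : u ∈ (e.extend I).target) :
    ContMDiffAt 𝓘(ℝ, E) I ∞ (e.extend I).symm u := by
  refine (contMDiffOn_extend_symm he).contMDiffAt ?_
  rw [← e.extend_target']
  exact e.isOpen_extend_target.mem_nhds hu

theorem mdifferentiableAt_extend_symm {e : OpenPartialHomeomorph M H}
    (he : e ∈ IsManifold.maximalAtlas I ∞ M) {u : E} (hu : u ∈ (e.extend I).target) :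
    MDifferentiableAt 𝓘(ℝ, E) I (e.extend I).symm u :=
  (contMDiffAt_extend_symm he hu).mdifferentiableAt (by simp)

theorem mfderiv_extend_symm_mfderiv_extend {e : OpenPartialHomeomorph M H}
    (he : e ∈ IsManifold.maximalAtlas I ∞ M) {p : M} (hp : p ∈ e.source) (v : TangentSpace I p) :
    mfderiv 𝓘(ℝ, E) I (e.extend I).symm (e.extend I p)
      (mfderiv I 𝓘(ℝ, E) (e.extend I) p v) = v := by
  have hu : e.extend I p ∈ (e.extend I).target :=
    (e.extend I).map_source (by rwa [e.extend_source])
  have h1 := (mdifferentiableAt_extend_symm he hu).hasMFDerivAt.comp p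
    (mdifferentiableAt_extend he hp).hasMFDerivAt
  have h2 : HasMFDerivAt I I ((e.extend I).symm ∘ (e.extend I)) p
      (ContinuousLinearMap.id ℝ (TangentSpace I p)) := by
    refine (hasMFDerivAt_id p).congr_of_eventuallyEq ?_
    filter_upwards [e.open_source.mem_nhds hp] with q hq
    exact e.extend_left_inv hq
  exact congrArg (fun L : TangentSpace I p →L[ℝ] TangentSpace I p => L v)
    (hasMFDerivAt_unique h1 h2)

theorem mfderiv_extend_mfderiv_extend_symm {e : OpenPartialHomeomorph M H}
    (he : e ∈ IsManifold.maximalAtlas I ∞ M) {u : E} (hu : u ∈ (e.extend I).target) (a : E) :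
    (mfderiv I 𝓘(ℝ, E) (e.extend I) ((e.extend I).symm u)
      (mfderiv 𝓘(ℝ, E) I (e.extend I).symm u a) : E) = a := by
  have hp : (e.extend I).symm u ∈ e.source := by
    rw [← e.extend_source (I := I)]; exact (e.extend I).map_target hu
  have h1 := (mdifferentiableAt_extend he hp).hasMFDerivAt.comp u
    (mdifferentiableAt_extend_symm he hu).hasMFDerivAt
  have h2 : HasMFDerivAt 𝓘(ℝ, E) 𝓘(ℝ, E) ((e.extend I) ∘ (e.extend I).symm) u
      (ContinuousLinearMap.id ℝ E) := by
    refine (hasMFDerivAt_id u).congr_of_eventuallyEq ?_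
    filter_upwards [e.isOpen_extend_target.mem_nhds hu] with q hq
    exact (e.extend I).right_inv hq
  exact congrArg (fun L : E →L[ℝ] E => L a) (hasMFDerivAt_unique h1 h2)

theorem exists_mfderiv_extend_eq {e : OpenPartialHomeomorph M H}
    (he : e ∈ IsManifold.maximalAtlas I ∞ M) {p : M} (hp : p ∈ e.source) (a : E) :
    ∃ v : TangentSpace I p, (mfderiv I 𝓘(ℝ, E) (e.extend I) p v : E) = a := by
  have h := mfderiv_extend_mfderiv_extend_symm he
    ((e.extend I).map_source (by rwa [e.extend_source])) a
  rw [e.extend_left_inv hp] at h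
  exact ⟨_, h⟩

/-- The tangent space of a set that is given by a linear subspace in a chart. -/
theorem mem_tangentTo_iff [FiniteDimensional ℝ E] {e : OpenPartialHomeomorph M H}
    (he : e ∈ IsManifold.maximalAtlas I ∞ M) {S : Set M} {p : M} (hpS : p ∈ S)
    (hp : p ∈ e.source) {W : Submodule ℝ E} (hW : ∀ q ∈ e.source, (q ∈ S ↔ e.extend I q ∈ W))
    (v : TangentSpace I p) :
    v ∈ tangentTo I S p ↔ (mfderiv I 𝓘(ℝ, E) (e.extend I) p v : E) ∈ W := by
  have hu : e.extend I p ∈ (e.extend I).target :=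
    (e.extend I).map_source (by rwa [e.extend_source])
  constructor
  · rintro ⟨γ, rfl, hγS, hγ, rfl⟩
    let D : ℝ →L[ℝ] E := (mfderiv I 𝓘(ℝ, E) (e.extend I) (γ 0)).comp (mfderiv 𝓘(ℝ, ℝ) I γ 0)
    have hd : HasMFDerivAt 𝓘(ℝ, ℝ) 𝓘(ℝ, E) (e.extend I ∘ γ) 0 D :=
      (mdifferentiableAt_extend he hp).hasMFDerivAt.comp 0
        (hγ.mdifferentiableAt (by simp)).hasMFDerivAt
    have hf : HasFDerivAt (e.extend I ∘ γ) D 0 := hasMFDerivAt_iff_hasFDerivAt.1 hd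
    have hd' := hf.hasDerivAt
    have hev : ∀ᶠ t in 𝓝 (0 : ℝ), (e.extend I ∘ γ) t ∈ W := by
      filter_upwards [hγS, hγ.continuousAt.preimage_mem_nhds (e.open_source.mem_nhds hp)] with t h1 h2
      exact (hW _ h2).1 h1
    have h0 : (e.extend I ∘ γ) 0 ∈ W := hev.self_of_nhds
    have hcl : IsClosed (W : Set E) := W.closed_of_finiteDimensional
    refine hcl.mem_of_tendsto (hasDerivAt_iff_tendsto_slope.1 hd') ?_
    filter_upwards [nhdsWithin_le_nhds hev] with t ht
    rw [slope_def_module]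
    exact W.smul_mem _ (W.sub_mem ht h0)
  · intro hv
    set w : E := mfderiv I 𝓘(ℝ, E) (e.extend I) p v with hw
    have hcurve : ContDiff ℝ ∞ fun t : ℝ => e.extend I p + t • w := by fun_prop
    have hc0 : (fun t : ℝ => e.extend I p + t • w) 0 = e.extend I p := by simp
    have hu0 : (fun t : ℝ => e.extend I p + t • w) 0 ∈ (e.extend I).target := by rwa [hc0]
    refine ⟨(e.extend I).symm ∘ fun t : ℝ => e.extend I p + t • w, ?_, ?_, ?_, ?_⟩
    · simp only [Function.comp_apply, zero_smul, add_zero]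
      exact e.extend_left_inv hp
    · have := hcurve.continuous.continuousAt.preimage_mem_nhds
        (e.isOpen_extend_target.mem_nhds hu0)
      filter_upwards [this] with t ht
      have hq : (e.extend I).symm (e.extend I p + t • w) ∈ e.source := by
        rw [← e.extend_source (I := I)]; exact (e.extend I).map_target ht
      refine (hW _ hq).2 ?_
      rw [(e.extend I).right_inv ht]
      exact W.add_mem ((hW p hp).1 hpS) (W.smul_mem _ hv)
    · exact (contMDiffAt_extend_symm he hu0).comp 0 hcurve.contMDiff.contMDiffAt
    · have hd : HasDerivAt (fun t : ℝ => e.extend I p + t • w) w 0 := by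
        simpa using ((hasDerivAt_id (0 : ℝ)).smul_const w).const_add (e.extend I p)
      have hm := (mdifferentiableAt_extend_symm he hu0).hasMFDerivAt.comp 0
        (hasMFDerivAt_iff_hasFDerivAt.2 hd.hasFDerivAt)
      rw [hm.mfderiv]
      have := mfderiv_extend_symm_mfderiv_extend he hp v
      rw [← hw] at this
      rw [← hc0] at this
      refine Eq.trans ?_ this
      exact congrArg _ (one_smul ℝ w)

/-- Around a point at which a set is the zero set of a submersion, it is given by a linear
subspace in a suitable chart. -/
theorem exists_chart_of_submersion [FiniteDimensional ℝ E] [IsManifold I ∞ M]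
    {Y : Type*} [NormedAddCommGroup Y] [NormedSpace ℝ Y] [FiniteDimensional ℝ Y]
    {e : OpenPartialHomeomorph M H}
    (he : e ∈ IsManifold.maximalAtlas I ∞ M) {S : Set M} {p : M}
    (hp : p ∈ e.source) {O : Set E} (hO : IsOpen O) (hpO : e.extend I p ∈ O) {Φ : E → Y}
    (hΦ : ContDiffOn ℝ ∞ Φ O) (hs : Function.Surjective (fderiv ℝ Φ (e.extend I p)))
    (hS : ∀ q ∈ e.source, e.extend I q ∈ O → (q ∈ S ↔ Φ (e.extend I q) = 0)) :
    ∃ e' ∈ IsManifold.maximalAtlas I ∞ M, p ∈ e'.source ∧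
      (∀ q ∈ e'.source, (q ∈ S ↔
        e'.extend I q ∈ LinearMap.ker (fderiv ℝ Φ (e.extend I p)).toLinearMap)) ∧
      ∀ v : TangentSpace I p, (mfderiv I 𝓘(ℝ, E) (e'.extend I) p v : E) =
        (mfderiv I 𝓘(ℝ, E) (e.extend I) p v : E) := by
  obtain ⟨ψ, hpψ, hψO, hψ, hψs, hψd, hψz⟩ := exists_straightening hO hΦ hpO hs
  let ψ' : OpenPartialHomeomorph H H :=
    (I.toHomeomorph.toOpenPartialHomeomorph.trans ψ).trans
      I.toHomeomorph.symm.toOpenPartialHomeomorph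
  let e' := e.trans ψ'
  have hext : ∀ q, e'.extend I q = ψ (e.extend I q) := fun q => by
    have : I (I.symm (ψ (I (e q)))) = ψ (I (e q)) := I.right_inv (by simp [I.range_eq_univ])
    simpa [e', ψ'] using this
  have hsrc : ∀ q ∈ e'.source, q ∈ e.source ∧ e.extend I q ∈ ψ.source := fun q hq => by
    simpa [e', ψ'] using hq
  have hsrc' : ∀ q, q ∈ e.source → e.extend I q ∈ ψ.source → q ∈ e'.source := fun q h1 h2 => by
    simpa [e', ψ'] using ⟨h1, h2⟩
  have hsm : ContMDiffOn I I ∞ e' e'.source := by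
    refine I.contMDiffOn_symm.comp (t := Set.range I)
      (hψ.contMDiffOn.comp ((e.contMDiffOn_extend he).mono fun q hq => (hsrc q hq).1)
        fun q hq => (hsrc q hq).2) fun q _ => by simp [I.range_eq_univ]
  have hsm' : ContMDiffOn I I ∞ e'.symm e'.target := by
    intro x hx
    have hx' : I x ∈ ψ.target ∧ ψ.symm (I x) ∈ (e.extend I).target := by
      simpa [e', ψ', e.extend_target, I.range_eq_univ] using hx
    exact ((contMDiffAt_extend_symm he hx'.2).comp x
      (((hψs.contDiffAt (ψ.open_target.mem_nhds hx'.1)).contMDiffAt).comp x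
        I.contMDiff.contMDiffAt)).contMDiffWithinAt
  refine ⟨e', e'.mem_maximalAtlas_of_contMDiffOn hsm hsm', hsrc' p hp hpψ, ?_, ?_⟩
  · intro q hq
    obtain ⟨h1, h2⟩ := hsrc q hq
    rw [hext, hS q h1 (hψO h2), hψz _ h2]
  · intro v
    have h1 : HasMFDerivAt I 𝓘(ℝ, E) (ψ ∘ e.extend I) p _ :=
      (hasMFDerivAt_iff_hasFDerivAt.2 hψd).comp p (mdifferentiableAt_extend he hp).hasMFDerivAt
    have h2 : (e'.extend I : M → E) = ψ ∘ e.extend I := funext hext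
    rw [h2, h1.mfderiv]
    rfl

end Charts

section LocalModel

set_option maxSynthPendingDepth 3

variable {E Q Y : Type*} [NormedAddCommGroup E] [NormedSpace ℝ E]
  [NormedAddCommGroup Q] [NormedSpace ℝ Q] [NormedAddCommGroup Y] [NormedSpace ℝ Y]
  (β : Q →L[ℝ] Q →L[ℝ] ℝ) (B : E → E →L[ℝ] E →L[ℝ] ℝ) (π : E →L[ℝ] Y) (f : E → Q)

/-- The frame of the `B`-complement of `ker π` that is indexed by the covectors of `Y`. -/
def complFrame (u : E) : (Y →L[ℝ] ℝ) →L[ℝ] E :=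
  (B u).inverse.comp ((ContinuousLinearMap.compL ℝ E Y ℝ).flip π)

/-- The map whose zero set in `E × ker π` is the set of those `(y, z)` for which `f y - f z` is
`β`-orthogonal to the image under `df` of the `B`-complement of `ker π` at `z`. -/
def sliceMap (p : E × E) : (Y →L[ℝ] ℝ) →L[ℝ] ℝ :=
  (β (f p.1 - f p.2)).comp ((fderiv ℝ f p.2).comp (complFrame B π p.2))

/-- The derivative of `sliceMap` in the direction of the complement of `ker π`. -/
def sliceDeriv (p : E × E) : (Y →L[ℝ] ℝ) →L[ℝ] (Y →L[ℝ] ℝ) →L[ℝ] ℝ :=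
  (fderiv ℝ (sliceMap β B π f) p).comp
    ((ContinuousLinearMap.inr ℝ E E).comp (complFrame B π p.2))

/-- The map with values in `Y** × Y` whose zero set is the slice. -/
def sliceEquation (p : E × E) : ((Y →L[ℝ] ℝ) →L[ℝ] ℝ) × Y :=
  (sliceMap β B π f p, π p.2)

/-- The points over `O` at which the slice is transverse to the complement of `ker π`. -/
def sliceRegion (O : Set E) : Set (E × E) :=
  {p ∈ O ×ˢ O | Function.Injective (sliceDeriv β B π f p)}

variable {β B π f} {O : Set E}

theorem apply_complFrame {u : E} (hu : (B u).IsInvertible) (α : Y →L[ℝ] ℝ) (w : E) :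
    B u (complFrame B π u α) w = α (π w) := by
  obtain ⟨L, hL⟩ := hu
  simp [complFrame, ← hL]

theorem exists_complFrame_eq [FiniteDimensional ℝ Y] (hπ : Function.Surjective π) {u : E}
    (hu : (B u).IsInvertible) {v : E} (hv : ∀ w, π w = 0 → B u v w = 0) :
    ∃ α, complFrame B π u α = v := by
  obtain ⟨S, hS⟩ := π.toLinearMap.exists_rightInverse_of_surjective (LinearMap.range_eq_top.2 hπ)
  have hS' : ∀ y, π (S y) = y := fun y => LinearMap.congr_fun hS y
  refine ⟨LinearMap.toContinuousLinearMap ((B u v).toLinearMap ∘ₗ S), ?_⟩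
  have hinj : Function.Injective (B u) := by
    obtain ⟨L, hL⟩ := hu
    rw [← hL]; exact L.injective
  apply hinj
  ext w
  rw [apply_complFrame hu]
  have := hv (w - S (π w)) (by rw [map_sub, hS', sub_self])
  rw [map_sub, sub_eq_zero] at this
  simpa using this.symm

theorem contDiffOn_complFrame [CompleteSpace E] (hB : ContDiffOn ℝ ∞ B O)
    (hBi : ∀ u ∈ O, (B u).IsInvertible) : ContDiffOn ℝ ∞ (complFrame B π) O := by
  intro u hu
  exact ((hBi u hu).contDiffAt_map_inverse.comp_contDiffWithinAt u (hB u hu)).clm_comp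
    contDiffWithinAt_const

theorem contDiffOn_sliceMap [CompleteSpace E] (hO : IsOpen O) (hB : ContDiffOn ℝ ∞ B O)
    (hBi : ∀ u ∈ O, (B u).IsInvertible) (hf : ContDiffOn ℝ ∞ f O) :
    ContDiffOn ℝ ∞ (sliceMap β B π f) (O ×ˢ O) := by
  have h1 : ContDiffOn ℝ ∞ (fun p : E × E => f p.1) (O ×ˢ O) :=
    hf.comp contDiff_fst.contDiffOn fun p hp => hp.1
  have h2 : ContDiffOn ℝ ∞ (fun p : E × E => f p.2) (O ×ˢ O) :=
    hf.comp contDiff_snd.contDiffOn fun p hp => hp.2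
  have h3 : ContDiffOn ℝ ∞ (fun p : E × E => fderiv ℝ f p.2) (O ×ˢ O) :=
    (hf.fderiv_of_isOpen hO (by simp)).comp contDiff_snd.contDiffOn fun p hp => hp.2
  have h4 : ContDiffOn ℝ ∞ (fun p : E × E => complFrame B π p.2) (O ×ˢ O) :=
    (contDiffOn_complFrame hB hBi).comp contDiff_snd.contDiffOn fun p hp => hp.2
  exact (β.contDiff.comp_contDiffOn (h1.sub h2)).clm_comp (h3.clm_comp h4)

theorem contDiffOn_sliceEquation [CompleteSpace E] (hO : IsOpen O) (hB : ContDiffOn ℝ ∞ B O)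
    (hBi : ∀ u ∈ O, (B u).IsInvertible) (hf : ContDiffOn ℝ ∞ f O) :
    ContDiffOn ℝ ∞ (sliceEquation β B π f) (O ×ˢ O) :=
  (contDiffOn_sliceMap hO hB hBi hf).prodMk (π.contDiff.comp contDiff_snd).contDiffOn

theorem isOpen_sliceRegion [CompleteSpace E] [FiniteDimensional ℝ Y] (hO : IsOpen O)
    (hB : ContDiffOn ℝ ∞ B O) (hBi : ∀ u ∈ O, (B u).IsInvertible) (hf : ContDiffOn ℝ ∞ f O) :
    IsOpen (sliceRegion β B π f O) := by
  have h1 : ContinuousOn (fderiv ℝ (sliceMap β B π f)) (O ×ˢ O) :=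
    (contDiffOn_sliceMap hO hB hBi hf).continuousOn_fderiv_of_isOpen (hO.prod hO) (by simp)
  have h2 : ContinuousOn (fun p : E × E => complFrame B π p.2) (O ×ˢ O) :=
    (contDiffOn_complFrame hB hBi).continuousOn.comp continuous_snd.continuousOn fun p hp => hp.2
  have h3 : ContinuousOn (sliceDeriv β B π f) (O ×ˢ O) :=
    h1.clm_comp (continuousOn_const.clm_comp h2)
  exact h3.isOpen_inter_preimage (hO.prod hO) ContinuousLinearMap.isOpen_injective

theorem sliceDeriv_diag [CompleteSpace E] (hO : IsOpen O) (hB : ContDiffOn ℝ ∞ B O)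
    (hBi : ∀ u ∈ O, (B u).IsInvertible) (hf : ContDiffOn ℝ ∞ f O) {x : E} (hx : x ∈ O)
    (α γ : Y →L[ℝ] ℝ) :
    sliceDeriv β B π f (x, x) α γ =
      -β (fderiv ℝ f x (complFrame B π x α)) (fderiv ℝ f x (complFrame B π x γ)) := by
  have hfx : HasFDerivAt f (fderiv ℝ f x) x :=
    ((hf.contDiffAt (hO.mem_nhds hx)).differentiableAt (by simp)).hasFDerivAt
  have h1 : HasFDerivAt (fun p : E × E => β (f p.1 - f p.2))
      (β.comp ((fderiv ℝ f x).comp (ContinuousLinearMap.fst ℝ E E) -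
        (fderiv ℝ f x).comp (ContinuousLinearMap.snd ℝ E E))) (x, x) :=
    β.hasFDerivAt.comp (x, x)
      ((HasFDerivAt.comp (x, x) (f := Prod.fst) hfx hasFDerivAt_fst).sub
        (HasFDerivAt.comp (x, x) (f := Prod.snd) hfx hasFDerivAt_snd))
  have h2 : ContDiffAt ℝ ∞ (fun u : E => (fderiv ℝ f u).comp (complFrame B π u)) x :=
    (((hf.fderiv_of_isOpen hO (by simp)).clm_comp (contDiffOn_complFrame hB hBi)).contDiffAt
      (hO.mem_nhds hx))
  have h3 : HasFDerivAt (fun p : E × E => (fderiv ℝ f p.2).comp (complFrame B π p.2)) _ (x, x) :=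
    HasFDerivAt.comp (x, x) (f := Prod.snd) (h2.differentiableAt (by simp)).hasFDerivAt
      hasFDerivAt_snd
  have h4 : HasFDerivAt (sliceMap β B π f) _ (x, x) := h1.clm_comp h3
  simp [sliceDeriv, h4.fderiv]

theorem diag_mem_sliceRegion [CompleteSpace E] (hβ : ∀ v, β v v = 0 → v = 0)
    (hπ : Function.Surjective π) (hO : IsOpen O) (hB : ContDiffOn ℝ ∞ B O)
    (hBi : ∀ u ∈ O, (B u).IsInvertible) (hf : ContDiffOn ℝ ∞ f O) {x : E} (hx : x ∈ O)
    (hfx : Function.Injective (fderiv ℝ f x)) : (x, x) ∈ sliceRegion β B π f O := by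
  refine ⟨⟨hx, hx⟩, (injective_iff_map_eq_zero _).2 fun α hα => ?_⟩
  have h := sliceDeriv_diag (β := β) (π := π) hO hB hBi hf hx α α
  rw [hα, eq_comm] at h
  have h1 := hβ _ (neg_eq_zero.1 h)
  have h2 : complFrame B π x α = 0 := hfx (by rw [h1, map_zero])
  ext y
  obtain ⟨w, rfl⟩ := hπ y
  rw [← apply_complFrame (hBi x hx) α w, h2]
  simp

theorem fderiv_sliceEquation [CompleteSpace E] (hO : IsOpen O) (hB : ContDiffOn ℝ ∞ B O)
    (hBi : ∀ u ∈ O, (B u).IsInvertible) (hf : ContDiffOn ℝ ∞ f O) {p : E × E}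
    (hp : p ∈ O ×ˢ O) (v : E × E) :
    fderiv ℝ (sliceEquation β B π f) p v = (fderiv ℝ (sliceMap β B π f) p v, π v.2) := by
  have h1 := (((contDiffOn_sliceMap (β := β) (π := π) hO hB hBi hf).contDiffAt
    ((hO.prod hO).mem_nhds hp)).differentiableAt (by simp)).hasFDerivAt
  have h2 : HasFDerivAt (sliceEquation β B π f) _ p :=
    h1.prodMk (π.hasFDerivAt.comp p hasFDerivAt_snd)
  rw [h2.fderiv]
  rfl

/-- Transversality: every vector can be moved to one that is annihilated by the derivative of
`sliceMap` by adding an element of the complement of `ker π` to its second component. -/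
theorem exists_fderiv_sliceMap_eq [FiniteDimensional ℝ Y] {p : E × E}
    (hp : p ∈ sliceRegion β B π f O) (v : E × E) (c : (Y →L[ℝ] ℝ) →L[ℝ] ℝ) :
    ∃ α, fderiv ℝ (sliceMap β B π f) p (v + (0, complFrame B π p.2 α)) = c := by
  have hsurj : Function.Surjective (sliceDeriv β B π f p) := by
    refine (LinearMap.injective_iff_surjective_of_finrank_eq_finrank
      (f := (sliceDeriv β B π f p).toLinearMap) ?_).1 hp.2
    have e1 : Module.finrank ℝ (Y →L[ℝ] ℝ) = Module.finrank ℝ Y := by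
      rw [← (LinearMap.toContinuousLinearMap (𝕜 := ℝ) (E := Y) (F' := ℝ)).finrank_eq]
      exact Subspace.dual_finrank_eq
    rw [← (LinearMap.toContinuousLinearMap (𝕜 := ℝ) (E := Y →L[ℝ] ℝ) (F' := ℝ)).finrank_eq]
    exact Subspace.dual_finrank_eq.symm
  obtain ⟨α, hα⟩ := hsurj (c - fderiv ℝ (sliceMap β B π f) p v)
  refine ⟨α, ?_⟩
  have : fderiv ℝ (sliceMap β B π f) p (0, complFrame B π p.2 α) =
    c - fderiv ℝ (sliceMap β B π f) p v := hα
  rw [map_add, this, add_sub_cancel]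

theorem surjective_fderiv_sliceEquation [CompleteSpace E] [FiniteDimensional ℝ Y]
    (hπ : Function.Surjective π) (hO : IsOpen O) (hB : ContDiffOn ℝ ∞ B O)
    (hBi : ∀ u ∈ O, (B u).IsInvertible) (hf : ContDiffOn ℝ ∞ f O) {p : E × E}
    (hp : p ∈ sliceRegion β B π f O) (hco : ∀ α, π (complFrame B π p.2 α) = 0) :
    Function.Surjective (fderiv ℝ (sliceEquation β B π f) p) := by
  rintro ⟨c, y⟩
  obtain ⟨b, rfl⟩ := hπ y
  obtain ⟨α, hα⟩ := exists_fderiv_sliceMap_eq hp (0, b) c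
  refine ⟨(0, b) + (0, complFrame B π p.2 α), ?_⟩
  rw [fderiv_sliceEquation hO hB hBi hf hp.1, hα]
  simp [hco]

theorem eq_zero_of_mem_ker_fderiv_sliceEquation [CompleteSpace E] [FiniteDimensional ℝ Y]
    (hπ : Function.Surjective π) (hO : IsOpen O) (hB : ContDiffOn ℝ ∞ B O)
    (hBi : ∀ u ∈ O, (B u).IsInvertible) (hBs : ∀ u ∈ O, ∀ v w, B u v w = -B u w v)
    (hf : ContDiffOn ℝ ∞ f O) {p : E × E}
    (hp : p ∈ sliceRegion β B π f O) (hco : ∀ α, π (complFrame B π p.2 α) = 0) {v : E × E}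
    (hv : fderiv ℝ (sliceEquation β B π f) p v = 0)
    (hvw : ∀ w, fderiv ℝ (sliceEquation β B π f) p w = 0 →
      B p.1 v.1 w.1 - B p.2 v.2 w.2 = 0) : v = 0 := by
  simp only [fderiv_sliceEquation hO hB hBi hf hp.1, Prod.mk_eq_zero] at hv hvw
  have hinj : ∀ u ∈ O, ∀ a, B u a = 0 → a = 0 := by
    intro u hu a ha
    obtain ⟨L, hL⟩ := hBi u hu
    rw [← hL] at ha
    exact L.map_eq_zero_iff.1 ha
  have key : ∀ w : E × E, π w.2 = 0 → B p.1 v.1 w.1 - B p.2 v.2 w.2 = 0 := by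
    intro w hw
    obtain ⟨α, hα⟩ := exists_fderiv_sliceMap_eq hp w 0
    have h := hvw _ ⟨hα, by simp [hw, hco]⟩
    have h' : B p.2 v.2 (complFrame B π p.2 α) = 0 := by
      rw [hBs _ hp.1.2, apply_complFrame (hBi _ hp.1.2), hv.2, map_zero, neg_zero]
    simpa [h'] using h
  have h1 : v.1 = 0 := hinj _ hp.1.1 _ (by ext a; simpa using key (a, 0) (by simp))
  obtain ⟨α, hα⟩ := exists_complFrame_eq hπ (hBi _ hp.1.2) (v := v.2)
    fun w hw => by simpa using key (0, w) hw
  have h2 : sliceDeriv β B π f p α = 0 := by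
    rw [← hv.1]
    change fderiv ℝ (sliceMap β B π f) p (0, complFrame B π p.2 α) = _
    rw [hα, ← h1]
  have h3 : α = 0 := hp.2 (by rw [h2, map_zero])
  rw [h3, map_zero] at hα
  exact Prod.ext h1 hα.symm

end LocalModel

section Forms

set_option maxSynthPendingDepth 3

/-- The bilinear form that underlies an alternating 2-form. -/
def altToBilin (E : Type*) [NormedAddCommGroup E] [NormedSpace ℝ E] :
    (E [⋀^Fin 2]→L[ℝ] ℝ) →L[ℝ] E →L[ℝ] E →L[ℝ] ℝ :=
  (ContinuousLinearMap.compL ℝ E (E [×1]→L[ℝ] ℝ) (E →L[ℝ] ℝ)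
      (continuousMultilinearCurryFin1 ℝ E ℝ).toContinuousLinearEquiv.toContinuousLinearMap).comp
    ((continuousMultilinearCurryLeftEquiv ℝ (fun _ : Fin 2 => E)
        ℝ).toContinuousLinearEquiv.toContinuousLinearMap.comp
      (ContinuousAlternatingMap.toContinuousMultilinearMapCLM ℝ))

theorem altToBilin_apply {E : Type*} [NormedAddCommGroup E] [NormedSpace ℝ E]
    (f : E [⋀^Fin 2]→L[ℝ] ℝ) (v w : E) : altToBilin E f v w = f ![v, w] := by
  simp only [altToBilin]
  change f (Fin.cons v (Fin.snoc 0 w)) = _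
  congr 1
  ext i
  fin_cases i <;> rfl

variable {E : Type*} [NormedAddCommGroup E] [NormedSpace ℝ E]
  {H : Type*} [TopologicalSpace H] {I : ModelWithCorners ℝ E H}
  {M : Type*} [TopologicalSpace M] [ChartedSpace H M]

/-- The bilinear form on `E` that represents `Ω` in the chart `e`. -/
def TwoForm.bilinInChart (Ω : TwoForm I M) (e : OpenPartialHomeomorph M H) (u : E) :
    E →L[ℝ] E →L[ℝ] ℝ :=
  altToBilin E ((Ω ((e.extend I).symm u)).compContinuousLinearMap
    (mfderiv 𝓘(ℝ, E) I (e.extend I).symm u))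

theorem TwoForm.bilinInChart_apply (Ω : TwoForm I M) (e : OpenPartialHomeomorph M H) (u a b : E) :
    Ω.bilinInChart e u a b = Ω ((e.extend I).symm u)
      ![mfderiv 𝓘(ℝ, E) I (e.extend I).symm u a, mfderiv 𝓘(ℝ, E) I (e.extend I).symm u b] := by
  rw [bilinInChart, altToBilin_apply]
  change Ω ((e.extend I).symm u) _ = _
  congr 1
  ext i
  fin_cases i <;> rfl

theorem TwoForm.bilinInChart_neg (Ω : TwoForm I M) (e : OpenPartialHomeomorph M H) (u a b : E) :
    Ω.bilinInChart e u a b = -Ω.bilinInChart e u b a := by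
  rw [bilinInChart, altToBilin_apply, altToBilin_apply]
  let g : E [⋀^Fin 2]→L[ℝ] ℝ := (Ω ((e.extend I).symm u)).compContinuousLinearMap
    (mfderiv 𝓘(ℝ, E) I (e.extend I).symm u)
  have h := g.toAlternatingMap.map_swap ![b, a] (i := 0) (j := 1) (by decide)
  have h2 : (![b, a] ∘ Equiv.swap (0 : Fin 2) 1 : Fin 2 → E) = ![a, b] := by
    ext i
    fin_cases i <;> rfl
  rw [h2] at h
  exact h

variable [I.Boundaryless]

theorem TwoForm.bilinInChart_mfderiv (Ω : TwoForm I M) {e : OpenPartialHomeomorph M H}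
    (he : e ∈ IsManifold.maximalAtlas I ∞ M) {p : M} (hp : p ∈ e.source)
    (v w : TangentSpace I p) :
    Ω.bilinInChart e (e.extend I p) (mfderiv I 𝓘(ℝ, E) (e.extend I) p v)
      (mfderiv I 𝓘(ℝ, E) (e.extend I) p w) = Ω p ![v, w] := by
  refine (bilinInChart_apply Ω e _ _ _).trans ?_
  have hv := mfderiv_extend_symm_mfderiv_extend he hp v
  have hw := mfderiv_extend_symm_mfderiv_extend he hp w
  have hp' := e.extend_left_inv (I := I) hp
  have key : ∀ (q : M) (_ : q = p) (a b v w : E), a = v → b = w →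
      (Ω q : E [⋀^Fin 2]→L[ℝ] ℝ) ![a, b] = (Ω p : E [⋀^Fin 2]→L[ℝ] ℝ) ![v, w] := by
    rintro q rfl a b v w rfl rfl; rfl
  exact key _ hp' _ _ _ _ hv hw

theorem IsSymplecticForm.isInvertible_bilinInChart [FiniteDimensional ℝ E] {Ω : TwoForm I M}
    (hΩ : IsSymplecticForm I Ω) {e : OpenPartialHomeomorph M H}
    (he : e ∈ IsManifold.maximalAtlas I ∞ M) {u : E} (hu : u ∈ (e.extend I).target) :
    (Ω.bilinInChart e u).IsInvertible := by
  have hp : (e.extend I).symm u ∈ e.source := by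
    rw [← e.extend_source (I := I)]; exact (e.extend I).map_target hu
  have hinj : Function.Injective (Ω.bilinInChart e u).toLinearMap := by
    refine (injective_iff_map_eq_zero _).2 fun a ha => ?_
    have h : mfderiv 𝓘(ℝ, E) I (e.extend I).symm u a = 0 := by
      refine hΩ.nondegenerate _ _ fun w => ?_
      have hw := mfderiv_extend_symm_mfderiv_extend he hp w
      rw [(e.extend I).right_inv hu] at hw
      rw [← hw]
      refine (TwoForm.bilinInChart_apply Ω e u a _).symm.trans ?_
      exact congrArg (fun L : E →L[ℝ] ℝ => L _) ha
    rw [← mfderiv_extend_mfderiv_extend_symm he hu a, h]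
    exact map_zero _
  have hrank : Module.finrank ℝ E = Module.finrank ℝ (E →L[ℝ] ℝ) := by
    rw [← (LinearMap.toContinuousLinearMap (𝕜 := ℝ) (E := E) (F' := ℝ)).finrank_eq]
    exact Subspace.dual_finrank_eq.symm
  exact ⟨(LinearEquiv.ofInjectiveOfFinrankEq _ hinj hrank).toContinuousLinearEquiv, by ext; rfl⟩

theorem IsSymplecticForm.contDiffOn_bilinInChart [FiniteDimensional ℝ E] [IsManifold I ∞ M]
    {Ω : TwoForm I M} (hΩ : IsSymplecticForm I Ω) {e : OpenPartialHomeomorph M H}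
    (he : e ∈ IsManifold.maximalAtlas I ∞ M) :
    ContDiffOn ℝ ∞ (Ω.bilinInChart e) (e.extend I).target := by
  refine contDiffOn_clm_apply.2 fun a => contDiffOn_clm_apply.2 fun b => fun u₀ hu₀ => ?_
  set x₀ := (e.extend I).symm u₀ with hx₀
  let τ : E → E := extChartAt I x₀ ∘ (e.extend I).symm
  have hx₀m := IsManifold.chart_mem_maximalAtlas (I := I) (n := ∞) x₀
  let O : Set E := (e.extend I).target ∩ (e.extend I).symm ⁻¹' (chartAt H x₀).source
  have hO : IsOpen O := e.continuousOn_extend_symm.isOpen_inter_preimage e.isOpen_extend_target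
    (chartAt H x₀).open_source
  have hu₀O : u₀ ∈ O := ⟨hu₀, mem_chart_source H x₀⟩
  have hτ : ContDiffOn ℝ ∞ τ O := fun u hu =>
    ((((chartAt H x₀).contMDiffAt_extend hx₀m hu.2).comp u
      (contMDiffAt_extend_symm he hu.1)).contDiffAt).contDiffWithinAt
  have hτt : ∀ u ∈ O, τ u ∈ (extChartAt I x₀).target := fun u hu =>
    (extChartAt I x₀).map_source (by rw [extChartAt_source]; exact hu.2)
  have hev : ∀ u ∈ O, Ω.bilinInChart e u a b =
      altToBilin E (TwoForm.inChart I Ω x₀ (τ u)) (fderiv ℝ τ u a) (fderiv ℝ τ u b) := by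
    intro u hu
    rw [altToBilin_apply, TwoForm.bilinInChart_apply]
    change _ = Ω ((extChartAt I x₀).symm (τ u)) _
    have hinv : (extChartAt I x₀).symm (τ u) = (e.extend I).symm u :=
      (chartAt H x₀).extend_left_inv hu.2
    have hcomp : HasMFDerivAt 𝓘(ℝ, E) I ((extChartAt I x₀).symm ∘ τ) u
        ((mfderiv 𝓘(ℝ, E) I (extChartAt I x₀).symm (τ u)).comp (fderiv ℝ τ u)) :=
      ((mdifferentiableAt_extend_symm hx₀m (hτt u hu)).hasMFDerivAt).comp u
        (hasMFDerivAt_iff_hasFDerivAt.2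
          ((hτ.contDiffAt (hO.mem_nhds hu)).differentiableAt (by simp)).hasFDerivAt)
    have hcongr : HasMFDerivAt 𝓘(ℝ, E) I (e.extend I).symm u
        ((mfderiv 𝓘(ℝ, E) I (extChartAt I x₀).symm (τ u)).comp (fderiv ℝ τ u)) := by
      refine hcomp.congr_of_eventuallyEq ?_
      filter_upwards [hO.mem_nhds hu] with y hy
      exact ((chartAt H x₀).extend_left_inv hy.2).symm
    have hD : ∀ c : E, (mfderiv 𝓘(ℝ, E) I (e.extend I).symm u c : E) =
        mfderiv 𝓘(ℝ, E) I (extChartAt I x₀).symm (τ u) (fderiv ℝ τ u c) := fun c => by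
      rw [hcongr.mfderiv]; rfl
    have key : ∀ (q p : M) (_ : q = p) (a b v w : E), a = v → b = w →
        (Ω q : E [⋀^Fin 2]→L[ℝ] ℝ) ![a, b] = (Ω p : E [⋀^Fin 2]→L[ℝ] ℝ) ![v, w] := by
      rintro q _ rfl a b v w rfl rfl; rfl
    refine (key _ _ hinv.symm _ _ _ _ (hD a) (hD b)).trans ?_
    congr 1
    ext i
    fin_cases i <;> rfl
  have h1 : ContDiffOn ℝ ∞ (fun u => altToBilin E (TwoForm.inChart I Ω x₀ (τ u))) O :=
    (altToBilin E).contDiff.comp_contDiffOn ((hΩ.smooth x₀).comp hτ hτt)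
  have h2 : ContDiffOn ℝ ∞ (fderiv ℝ τ) O := hτ.fderiv_of_isOpen hO (by simp)
  have h3 := ((h1.clm_apply (h2.clm_apply (contDiffOn_const (c := a)))).clm_apply
    (h2.clm_apply (contDiffOn_const (c := b)))).congr hev
  exact (h3.contDiffAt (hO.mem_nhds hu₀O)).contDiffWithinAt

end Forms

/-- A smooth map to a Euclidean space that is an immersion along a given compact set. -/
theorem exists_contMDiff_injective_mfderiv_of_isCompact {E : Type*} [NormedAddCommGroup E]
    [NormedSpace ℝ E] [FiniteDimensional ℝ E] {H : Type*} [TopologicalSpace H]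
    (I : ModelWithCorners ℝ E H) {M : Type*} [TopologicalSpace M] [ChartedSpace H M] [T2Space M]
    [IsManifold I ∞ M] {N : Set M} (hN : IsCompact N) :
    ∃ (r : ℕ) (F : M → EuclideanSpace ℝ (Fin r)),
      ContMDiff I 𝓘(ℝ, EuclideanSpace ℝ (Fin r)) ∞ F ∧
      ∀ x ∈ N, Function.Injective (mfderiv I 𝓘(ℝ, EuclideanSpace ℝ (Fin r)) F x) := by
  let b : ∀ x : M, SmoothBumpFunction I x := fun x => Classical.arbitrary _
  have hU : ∀ x, {y | b x =ᶠ[𝓝 y] 1} ∩ (chartAt H x).source ∈ 𝓝 x := fun x =>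
    Filter.inter_mem ((b x).eventuallyEq_one.eventually_nhds) (chart_source_mem_nhds H x)
  obtain ⟨t, -, ht⟩ := hN.elim_nhds_subcover _ fun x _ => hU x
  let F₀ : M → (t → E) := fun y i => b i y • extChartAt I (i : M) y
  have hF₀ : ContMDiff I 𝓘(ℝ, t → E) ∞ F₀ :=
    contMDiff_pi_space.2 fun i => (b i).contMDiff_smul contMDiffOn_extChartAt
  let L : (t → E) ≃L[ℝ] EuclideanSpace ℝ (Fin (Module.finrank ℝ (t → E))) :=
    ContinuousLinearEquiv.ofFinrankEq finrank_euclideanSpace_fin.symm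
  refine ⟨_, L ∘ F₀, L.contDiff.contMDiff.comp hF₀, fun x hx => ?_⟩
  obtain ⟨i, hi, hxi⟩ := Set.mem_iUnion₂.1 (ht hx)
  have hFd := (hF₀.mdifferentiableAt (x := x) (by simp)).hasMFDerivAt
  let pr : (t → E) →L[ℝ] E := ContinuousLinearMap.proj (⟨i, hi⟩ : t)
  have h1 : HasMFDerivAt I 𝓘(ℝ, E) (pr ∘ F₀) x _ := pr.hasMFDerivAt.comp x hFd
  have h2 : HasMFDerivAt I 𝓘(ℝ, E) (pr ∘ F₀) x (mfderiv I 𝓘(ℝ, E) (extChartAt I i) x) := by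
    refine (mdifferentiableAt_extChartAt hxi.2).hasMFDerivAt.congr_of_eventuallyEq ?_
    filter_upwards [hxi.1] with y hy
    simp only [Function.comp_apply]
    change b i y • extChartAt I i y = _
    rw [hy]
    simp
  have h3 : Function.Injective (mfderiv I 𝓘(ℝ, E) (extChartAt I i) x) := by
    obtain ⟨A, hA⟩ := isInvertible_mfderiv_extChartAt (I := I) (x := i) (y := x)
      (by rw [extChartAt_source]; exact hxi.2)
    rw [← hA]
    exact A.injective
  have h4 : HasMFDerivAt I 𝓘(ℝ, EuclideanSpace ℝ (Fin (Module.finrank ℝ (t → E)))) (L ∘ F₀) x _ :=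
    L.toContinuousLinearMap.hasMFDerivAt.comp x hFd
  rw [h4.mfderiv]
  refine L.injective.comp (Function.Injective.of_comp (f := pr) ?_)
  have := hasMFDerivAt_unique h1 h2
  rw [← this] at h3
  exact h3

theorem exists_continuousLinearMap_ker_eq {E : Type*} [NormedAddCommGroup E] [NormedSpace ℝ E]
    [FiniteDimensional ℝ E] (W : Submodule ℝ E) {k : ℕ}
    (hW : Module.finrank ℝ W + k = Module.finrank ℝ E) :
    ∃ π : E →L[ℝ] (Fin k → ℝ), Function.Surjective π ∧ ∀ v, π v = 0 ↔ v ∈ W := by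
  have h : Module.finrank ℝ (E ⧸ W) = Module.finrank ℝ (Fin k → ℝ) := by
    have := W.finrank_quotient_add_finrank
    rw [Module.finrank_fin_fun]
    omega
  let L := LinearEquiv.ofFinrankEq _ _ h
  refine ⟨LinearMap.toContinuousLinearMap (L.toLinearMap ∘ₗ W.mkQ),
    L.surjective.comp W.mkQ_surjective, fun v => ?_⟩
  simp

section Diagonal

variable {E : Type*} [NormedAddCommGroup E] [NormedSpace ℝ E]
  {H : Type*} [TopologicalSpace H] {I : ModelWithCorners ℝ E H}
  {M : Type*} [TopologicalSpace M]

/-- The diagonal of `W × W`. -/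
def diagSubmodule (W : Submodule ℝ E) : Submodule ℝ (E × E) :=
  W.map (LinearMap.prod LinearMap.id LinearMap.id)

theorem mem_diagSubmodule {W : Submodule ℝ E} {v : E × E} :
    v ∈ diagSubmodule W ↔ v.1 ∈ W ∧ v.1 = v.2 := by
  constructor
  · rintro ⟨w, hw, rfl⟩
    exact ⟨hw, rfl⟩
  · rintro ⟨h1, h2⟩
    exact ⟨v.1, h1, Prod.ext rfl h2⟩

theorem diagonal_chart {N : Set M} {e : OpenPartialHomeomorph M H} {W : Submodule ℝ E}
    (hW : ∀ q ∈ e.source, (q ∈ N ↔ e.extend I q ∈ W)) :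
    ∀ q ∈ (e.prod e).source,
      (q ∈ diagonalOf N ↔ (e.prod e).extend (I.prod I) q ∈ diagSubmodule W) := by
  rintro ⟨y, z⟩ ⟨hy, hz⟩
  have hinj : e.extend I y = e.extend I z ↔ y = z :=
    (e.extend I).injOn.eq_iff (by rwa [e.extend_source]) (by rwa [e.extend_source])
  rw [mem_diagSubmodule, OpenPartialHomeomorph.extend_prod]
  change _ ↔ e.extend I y ∈ W ∧ e.extend I y = e.extend I z
  rw [hinj, ← hW y hy]
  constructor
  · rintro ⟨x, hx, h⟩
    obtain ⟨rfl, rfl⟩ := Prod.mk.inj h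
    exact ⟨hx, rfl⟩
  · rintro ⟨h, rfl⟩
    exact ⟨y, h, rfl⟩

variable [ChartedSpace H M]

theorem TwoForm.prodNeg_apply (Ω : TwoForm I M) (p : M × M)
    (v w : TangentSpace (I.prod I) p) :
    Ω.prodNeg I p ![v, w] = Ω p.1 ![v.1, w.1] - Ω p.2 ![v.2, w.2] := by
  have key : ∀ (q : M) (L : TangentSpace (I.prod I) p →L[ℝ] TangentSpace I q),
      ((Ω q).compContinuousLinearMap L) ![v, w] = Ω q ![L v, L w] := by
    intro q L
    change Ω q _ = _
    congr 1
    ext i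
    fin_cases i <;> rfl
  change ((Ω p.1).compContinuousLinearMap _) ![v, w] -
    ((Ω p.2).compContinuousLinearMap _) ![v, w] = _
  rw [key, key, mfderiv_fst, mfderiv_snd]
  rfl

variable [IsManifold I ∞ M]

theorem mfderiv_extend_prod {e : OpenPartialHomeomorph M H}
    (he : e ∈ IsManifold.maximalAtlas I ∞ M) {p : M × M} (hp : p ∈ (e.prod e).source)
    (v : TangentSpace (I.prod I) p) :
    (mfderiv (I.prod I) 𝓘(ℝ, E × E) ((e.prod e).extend (I.prod I)) p v : E × E) =
      (mfderiv I 𝓘(ℝ, E) (e.extend I) p.1 v.1, mfderiv I 𝓘(ℝ, E) (e.extend I) p.2 v.2) := by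
  have h1 : HasMFDerivAt (I.prod I) 𝓘(ℝ, E) (fun q : M × M => e.extend I q.1) p _ :=
    (mdifferentiableAt_extend he hp.1).hasMFDerivAt.comp p (hasMFDerivAt_fst p)
  have h2 : HasMFDerivAt (I.prod I) 𝓘(ℝ, E) (fun q : M × M => e.extend I q.2) p _ :=
    (mdifferentiableAt_extend he hp.2).hasMFDerivAt.comp p (hasMFDerivAt_snd p)
  have h3 := (mdifferentiableAt_extend (IsManifold.mem_maximalAtlas_prod he he) hp).hasMFDerivAt
  have h4 : ((e.prod e).extend (I.prod I) : M × M → E × E) =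
      fun q => (e.extend I q.1, e.extend I q.2) := by
    rw [OpenPartialHomeomorph.extend_prod]; rfl
  have h5 : HasMFDerivAt (I.prod I) 𝓘(ℝ, E) (fun q : M × M => e.extend I q.1) p
      ((ContinuousLinearMap.fst ℝ E E).comp
        (mfderiv (I.prod I) 𝓘(ℝ, E × E) ((e.prod e).extend (I.prod I)) p)) := by
    have := (ContinuousLinearMap.fst ℝ E E).hasMFDerivAt.comp p h3
    rwa [h4] at this ⊢
  have h6 : HasMFDerivAt (I.prod I) 𝓘(ℝ, E) (fun q : M × M => e.extend I q.2) p
      ((ContinuousLinearMap.snd ℝ E E).comp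
        (mfderiv (I.prod I) 𝓘(ℝ, E × E) ((e.prod e).extend (I.prod I)) p)) := by
    have := (ContinuousLinearMap.snd ℝ E E).hasMFDerivAt.comp p h3
    rwa [h4] at this ⊢
  exact Prod.ext
    (congrArg (fun L : E × E →L[ℝ] E => L v) (hasMFDerivAt_unique h5 h1))
    (congrArg (fun L : E × E →L[ℝ] E => L v) (hasMFDerivAt_unique h6 h2))

theorem isSubmanifold_diagonalOf {N : Set M} {d : ℕ} (hN : IsSubmanifold I d N) :
    IsSubmanifold (I.prod I) d (diagonalOf N) := by
  rintro _ ⟨x, hx, rfl⟩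
  obtain ⟨e, he, hxe, W, hWd, hW⟩ := hN x hx
  refine ⟨e.prod e, IsManifold.mem_maximalAtlas_prod he he, ⟨hxe, hxe⟩, diagSubmodule W, ?_,
    diagonal_chart hW⟩
  rw [← hWd]
  exact (Submodule.equivMapOfInjective _ (fun a b h => (Prod.mk.inj h).1) W).finrank_eq.symm

variable [FiniteDimensional ℝ E] [I.Boundaryless]

theorem fst_eq_snd_of_mem_tangentTo_diagonalOf {N : Set M} {d : ℕ} (hN : IsSubmanifold I d N)
    {x : M} (hx : x ∈ N) {v : TangentSpace (I.prod I) (x, x)}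
    (hv : v ∈ tangentTo (I.prod I) (diagonalOf N) (x, x)) : (v.1 : E) = v.2 := by
  obtain ⟨e, he, hxe, W, hWd, hW⟩ := hN x hx
  have hxx : (x, x) ∈ diagonalOf N := ⟨x, hx, rfl⟩
  have h := mem_diagSubmodule.1 ((mem_tangentTo_iff (IsManifold.mem_maximalAtlas_prod he he) hxx
    ⟨hxe, hxe⟩ (diagonal_chart hW) v).1 hv)
  have h2 := mfderiv_extend_prod he (p := (x, x)) ⟨hxe, hxe⟩ v
  have h3 : (mfderiv I 𝓘(ℝ, E) (e.extend I) x v.1 : E) = mfderiv I 𝓘(ℝ, E) (e.extend I) x v.2 :=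
    (congrArg Prod.fst h2).symm.trans (h.2.trans (congrArg Prod.snd h2))
  rw [← mfderiv_extend_symm_mfderiv_extend he hxe v.1,
    ← mfderiv_extend_symm_mfderiv_extend he hxe v.2]
  exact congrArg _ h3

/-- A symplectic submanifold of twice the dimension of `N` that contains the diagonal embedding of
`N` contains it as a Lagrangian submanifold. -/
theorem isLagrangianSubmanifoldOf_diagonalOf {N : Set M} {d D : ℕ} (hN : IsSubmanifold I d N)
    (hD : 2 * d = D) (Ω : TwoForm I M) {P : Set (M × M)}
    (hP : IsSymplecticSubmanifold (I.prod I) (Ω.prodNeg I) D P) (hNP : diagonalOf N ⊆ P) :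
    IsLagrangianSubmanifoldOf (I.prod I) (Ω.prodNeg I) D P (diagonalOf N) := by
  refine ⟨hP, hNP, ⟨d, hD, isSubmanifold_diagonalOf hN⟩, ?_⟩
  rintro _ ⟨x, hx, rfl⟩ v hv w hw
  have h1 := fst_eq_snd_of_mem_tangentTo_diagonalOf hN hx hv
  have h2 := fst_eq_snd_of_mem_tangentTo_diagonalOf hN hx hw
  rw [TwoForm.prodNeg_apply, sub_eq_zero]
  exact congrArg₂ (fun a b : E => (Ω x : E [⋀^Fin 2]→L[ℝ] ℝ) ![a, b]) h1 h2

end Diagonal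

section Slice

set_option maxSynthPendingDepth 3

variable {E : Type*} [NormedAddCommGroup E] [NormedSpace ℝ E]
  {H : Type*} [TopologicalSpace H] (I : ModelWithCorners ℝ E H)
  {M : Type*} [TopologicalSpace M] [ChartedSpace H M]
  {Q : Type*} [NormedAddCommGroup Q] [NormedSpace ℝ Q] {Y : Type*} [NormedAddCommGroup Y]
  [NormedSpace ℝ Y]

/-- The pairs `(y, z)` with `z ∈ N` for which `F y - F z` is `β`-orthogonal to the image under
`dF` of the symplectic complement of `T_z N`. -/
def orthoSlice (Ω : TwoForm I M) (N : Set M) (β : Q →L[ℝ] Q →L[ℝ] ℝ) (F : M → Q) : Set (M × M) :=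
  {p | p.2 ∈ N ∧ ∀ v : TangentSpace I p.2, (∀ w ∈ tangentTo I N p.2, Ω p.2 ![v, w] = 0) →
    β (F p.1 - F p.2) (mfderiv I 𝓘(ℝ, Q) F p.2 v) = 0}

variable {I} {Ω : TwoForm I M} {N : Set M} {β : Q →L[ℝ] Q →L[ℝ] ℝ} {F : M → Q}

theorem diagonalOf_subset_orthoSlice : diagonalOf N ⊆ orthoSlice I Ω N β F := by
  rintro _ ⟨x, hx, rfl⟩
  refine ⟨hx, fun v _ => ?_⟩
  change β (F x - F x) _ = 0
  rw [sub_self, map_zero]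
  rfl

variable [I.Boundaryless] {e : OpenPartialHomeomorph M H}

theorem fderiv_comp_extend_symm (he : e ∈ IsManifold.maximalAtlas I ∞ M)
    (hF : ContMDiff I 𝓘(ℝ, Q) ∞ F) {z : M} (hz : z ∈ e.source) (v : TangentSpace I z) :
    fderiv ℝ (F ∘ (e.extend I).symm) (e.extend I z) (mfderiv I 𝓘(ℝ, E) (e.extend I) z v) =
      mfderiv I 𝓘(ℝ, Q) F z v := by
  have hu : e.extend I z ∈ (e.extend I).target :=
    (e.extend I).map_source (by rwa [e.extend_source])
  have h1 : HasMFDerivAt 𝓘(ℝ, E) 𝓘(ℝ, Q) (F ∘ (e.extend I).symm) (e.extend I z) _ :=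
    (hF.mdifferentiableAt (by simp)).hasMFDerivAt.comp _
      (mdifferentiableAt_extend_symm he hu).hasMFDerivAt
  rw [← mfderiv_eq_fderiv, h1.mfderiv]
  have hv := mfderiv_extend_symm_mfderiv_extend he hz v
  have key : ∀ (q : M) (_ : q = z) (a b : E), a = b →
      (mfderiv I 𝓘(ℝ, Q) F q a : Q) = mfderiv I 𝓘(ℝ, Q) F z b := by
    rintro q rfl a b rfl; rfl
  exact key _ (e.extend_left_inv hz) _ _ hv

theorem contDiffOn_comp_extend_symm (he : e ∈ IsManifold.maximalAtlas I ∞ M)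
    (hF : ContMDiff I 𝓘(ℝ, Q) ∞ F) :
    ContDiffOn ℝ ∞ (F ∘ (e.extend I).symm) (e.extend I).target := fun u hu =>
  ((hF _).comp u (contMDiffAt_extend_symm he hu)).contDiffAt.contDiffWithinAt

variable [FiniteDimensional ℝ E] [FiniteDimensional ℝ Y] {W : Submodule ℝ E} {π : E →L[ℝ] Y}

/-- The symplectic complement of `T_z N` in an adapted chart. -/
theorem forall_tangentTo_iff_exists_complFrame (hΩ : IsSymplecticForm I Ω)
    (he : e ∈ IsManifold.maximalAtlas I ∞ M)
    (hW : ∀ q ∈ e.source, (q ∈ N ↔ e.extend I q ∈ W)) (hπ : Function.Surjective π)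
    (hπW : ∀ v, π v = 0 ↔ v ∈ W) {z : M} (hz : z ∈ e.source) (hzN : z ∈ N)
    (v : TangentSpace I z) :
    (∀ w ∈ tangentTo I N z, Ω z ![v, w] = 0) ↔
      ∃ α, complFrame (Ω.bilinInChart e) π (e.extend I z) α =
        (mfderiv I 𝓘(ℝ, E) (e.extend I) z v : E) := by
  have hu : e.extend I z ∈ (e.extend I).target :=
    (e.extend I).map_source (by rwa [e.extend_source])
  have hinv := hΩ.isInvertible_bilinInChart he hu
  constructor
  · intro h
    refine exists_complFrame_eq hπ hinv fun w hw => ?_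
    obtain ⟨w', hw'⟩ := exists_mfderiv_extend_eq he hz w
    have hwN : w' ∈ tangentTo I N z :=
      (mem_tangentTo_iff he hzN hz hW w').2 ((congrArg (· ∈ W) hw').mpr ((hπW w).1 hw))
    exact (congrArg _ hw'.symm).trans ((Ω.bilinInChart_mfderiv he hz v w').trans (h w' hwN))
  · rintro ⟨α, hα⟩ w hw
    rw [← Ω.bilinInChart_mfderiv he hz]
    refine Eq.trans (congrArg (fun a : E => Ω.bilinInChart e (e.extend I z) a
      (mfderiv I 𝓘(ℝ, E) (e.extend I) z w)) hα.symm) ?_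
    refine (apply_complFrame hinv α _).trans ?_
    rw [(hπW _).2 ((mem_tangentTo_iff he hzN hz hW w).1 hw), map_zero]

theorem apply_complFrame_eq_zero_of_coisotropic (hΩ : IsSymplecticForm I Ω) {d : ℕ}
    (hN : IsCoisotropicSubmanifold I Ω d N) (he : e ∈ IsManifold.maximalAtlas I ∞ M)
    (hW : ∀ q ∈ e.source, (q ∈ N ↔ e.extend I q ∈ W)) (hπ : Function.Surjective π)
    (hπW : ∀ v, π v = 0 ↔ v ∈ W) {z : M} (hz : z ∈ e.source) (hzN : z ∈ N)
    (α : Y →L[ℝ] ℝ) : π (complFrame (Ω.bilinInChart e) π (e.extend I z) α) = 0 := by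
  set a := complFrame (Ω.bilinInChart e) π (e.extend I z) α with ha
  obtain ⟨v, hv⟩ := exists_mfderiv_extend_eq he hz a
  have h := hN.2 z hzN v ((forall_tangentTo_iff_exists_complFrame hΩ he hW hπ hπW hz hzN v).2
    ⟨α, hv.symm⟩)
  rw [hπW, ← hv]
  exact (mem_tangentTo_iff he hzN hz hW v).1 h

theorem mem_orthoSlice_iff (hΩ : IsSymplecticForm I Ω) (hF : ContMDiff I 𝓘(ℝ, Q) ∞ F)
    (he : e ∈ IsManifold.maximalAtlas I ∞ M)
    (hW : ∀ q ∈ e.source, (q ∈ N ↔ e.extend I q ∈ W)) (hπ : Function.Surjective π)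
    (hπW : ∀ v, π v = 0 ↔ v ∈ W) {p : M × M} (hp : p ∈ (e.prod e).source) :
    p ∈ orthoSlice I Ω N β F ↔ sliceEquation β (Ω.bilinInChart e) π (F ∘ (e.extend I).symm)
      (e.extend I p.1, e.extend I p.2) = 0 := by
  obtain ⟨y, z⟩ := p
  obtain ⟨hy, hz⟩ := hp
  change y ∈ e.source at hy
  change z ∈ e.source at hz
  have hmap : ∀ α, sliceMap β (Ω.bilinInChart e) π (F ∘ (e.extend I).symm)
      (e.extend I y, e.extend I z) α = β (F y - F z) (fderiv ℝ (F ∘ (e.extend I).symm)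
        (e.extend I z) (complFrame (Ω.bilinInChart e) π (e.extend I z) α)) := by
    intro α
    change β (F ((e.extend I).symm (e.extend I y)) - F ((e.extend I).symm (e.extend I z))) _ = _
    rw [e.extend_left_inv hy, e.extend_left_inv hz]
    rfl
  rw [sliceEquation, Prod.mk_eq_zero, hπW, ← hW z hz, and_comm]
  refine and_congr_right fun hzN => ?_
  have hK := forall_tangentTo_iff_exists_complFrame hΩ he hW hπ hπW hz hzN
  constructor
  · intro h
    ext α
    set a := complFrame (Ω.bilinInChart e) π (e.extend I z) α with ha
    obtain ⟨v, hv⟩ := exists_mfderiv_extend_eq he hz a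
    rw [hmap, ← ha, ← hv]
    refine Eq.trans ?_ (h v ((hK v).2 ⟨α, hv.symm⟩))
    exact congrArg _ (fderiv_comp_extend_symm he hF hz v)
  · intro h v hv
    obtain ⟨α, hα⟩ := (hK v).1 hv
    have h1 := hmap α
    rw [h, hα] at h1
    refine Eq.trans ?_ h1.symm
    exact congrArg _ (fderiv_comp_extend_symm he hF hz v).symm

variable [IsManifold I ∞ M]

/-- A subset of `M × M` that agrees with `orthoSlice` near each of its points, and has all its
points in regions of transversality, is a symplectic submanifold. -/
theorem isSymplecticSubmanifold_of_sliceRegion (hΩ : IsSymplecticForm I Ω) {d D : ℕ}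
    (hN : IsCoisotropicSubmanifold I Ω d N) (hF : ContMDiff I 𝓘(ℝ, Q) ∞ F) {P : Set (M × M)}
    (hD : D + 2 * Module.finrank ℝ Y = 2 * Module.finrank ℝ E)
    (hP : ∀ p ∈ P, ∃ e ∈ IsManifold.maximalAtlas I ∞ M, ∃ (W : Submodule ℝ E) (π : E →L[ℝ] Y),
      (∀ q ∈ e.source, (q ∈ N ↔ e.extend I q ∈ W)) ∧ Function.Surjective π ∧
      (∀ v, π v = 0 ↔ v ∈ W) ∧ p ∈ (e.prod e).source ∧
      (e.extend I p.1, e.extend I p.2) ∈ sliceRegion β (Ω.bilinInChart e) π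
        (F ∘ (e.extend I).symm) (e.extend I).target ∧
      ∀ q ∈ (e.prod e).source, (e.extend I q.1, e.extend I q.2) ∈
        sliceRegion β (Ω.bilinInChart e) π (F ∘ (e.extend I).symm) (e.extend I).target →
        (q ∈ P ↔ q ∈ orthoSlice I Ω N β F)) :
    IsSymplecticSubmanifold (I.prod I) (Ω.prodNeg I) D P := by
  have main : ∀ p ∈ P, ∃ e' ∈ IsManifold.maximalAtlas (I.prod I) ∞ (M × M), p ∈ e'.source ∧
      ∃ W' : Submodule ℝ (E × E), Module.finrank ℝ W' = D ∧
      (∀ q ∈ e'.source, (q ∈ P ↔ e'.extend (I.prod I) q ∈ W')) ∧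
      ∀ v ∈ tangentTo (I.prod I) P p,
        (∀ w ∈ tangentTo (I.prod I) P p, Ω.prodNeg I p ![v, w] = 0) → v = 0 := by
    intro p hpP
    obtain ⟨e, he, W, π, hW, hπ, hπW, hp, hpR, hloc⟩ := hP p hpP
    have hee := IsManifold.mem_maximalAtlas_prod he he
    have hO := e.isOpen_extend_target (I := I)
    have hB := hΩ.contDiffOn_bilinInChart he
    have hBi : ∀ u ∈ (e.extend I).target, (Ω.bilinInChart e u).IsInvertible := fun u hu =>
      hΩ.isInvertible_bilinInChart he hu
    have hf := contDiffOn_comp_extend_symm he hF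
    have hext : ∀ q : M × M, (e.prod e).extend (I.prod I) q = (e.extend I q.1, e.extend I q.2) := by
      intro q
      rw [OpenPartialHomeomorph.extend_prod]; rfl
    have hpN : p.2 ∈ N := ((hloc p hp hpR).1 hpP).1
    have hco := apply_complFrame_eq_zero_of_coisotropic hΩ hN he hW hπ hπW hp.2 hpN
    have hsurj := surjective_fderiv_sliceEquation hπ hO hB hBi hf hpR hco
    obtain ⟨e', he', hpe', hWe', hde'⟩ := exists_chart_of_submersion (I := I.prod I) hee hp
      (isOpen_sliceRegion (β := β) (π := π) hO hB hBi hf) (by rw [hext]; exact hpR)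
      ((contDiffOn_sliceEquation hO hB hBi hf).mono fun q hq => hq.1)
      (by rw [hext]; exact hsurj) (S := P)
      (fun q hq hqR => by
        rw [hext] at hqR ⊢
        rw [hloc q hq hqR, mem_orthoSlice_iff hΩ hF he hW hπ hπW hq])
    rw [hext] at hWe'
    set A := fderiv ℝ (sliceEquation β (Ω.bilinInChart e) π (F ∘ (e.extend I).symm))
      (e.extend I p.1, e.extend I p.2) with hA
    refine ⟨e', he', hpe', LinearMap.ker A.toLinearMap, ?_, hWe', ?_⟩
    · have h1 := A.toLinearMap.finrank_range_add_finrank_ker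
      have e1 : Module.finrank ℝ (Y →L[ℝ] ℝ) = Module.finrank ℝ Y := by
        rw [← (LinearMap.toContinuousLinearMap (𝕜 := ℝ) (E := Y) (F' := ℝ)).finrank_eq]
        exact Subspace.dual_finrank_eq
      have e2 : Module.finrank ℝ ((Y →L[ℝ] ℝ) →L[ℝ] ℝ) = Module.finrank ℝ (Y →L[ℝ] ℝ) := by
        rw [← (LinearMap.toContinuousLinearMap (𝕜 := ℝ) (E := Y →L[ℝ] ℝ) (F' := ℝ)).finrank_eq]
        exact Subspace.dual_finrank_eq
      rw [LinearMap.range_eq_top.2 hsurj, finrank_top, Module.finrank_prod, Module.finrank_prod,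
        e2, e1] at h1
      omega
    · have htan : ∀ v : TangentSpace (I.prod I) p, v ∈ tangentTo (I.prod I) P p ↔
          A (mfderiv I 𝓘(ℝ, E) (e.extend I) p.1 v.1, mfderiv I 𝓘(ℝ, E) (e.extend I) p.2 v.2) =
            0 := by
        intro v
        refine (mem_tangentTo_iff he' hpP hpe' hWe' v).trans ?_
        refine Iff.trans (Eq.to_iff (congrArg (fun a : E × E => A a = 0)
          ((hde' v).trans (mfderiv_extend_prod he hp v)))) Iff.rfl
      intro v hv hvw
      have hz := eq_zero_of_mem_ker_fderiv_sliceEquation hπ hO hB hBi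
        (fun u _ => Ω.bilinInChart_neg e u) hf hpR hco ((htan v).1 hv) ?_
      · have h1 : (mfderiv I 𝓘(ℝ, E) (e.extend I) p.1 v.1 : E) = 0 := congrArg Prod.fst hz
        have h2 : (mfderiv I 𝓘(ℝ, E) (e.extend I) p.2 v.2 : E) = 0 := congrArg Prod.snd hz
        have h3 := mfderiv_extend_symm_mfderiv_extend he hp.1 v.1
        have h4 := mfderiv_extend_symm_mfderiv_extend he hp.2 v.2
        refine Prod.ext (h3.symm.trans ?_) (h4.symm.trans ?_)
        · exact (congrArg _ h1).trans (map_zero _)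
        · exact (congrArg _ h2).trans (map_zero _)
      · intro w hw
        obtain ⟨w1, hw1⟩ := exists_mfderiv_extend_eq he hp.1 w.1
        obtain ⟨w2, hw2⟩ := exists_mfderiv_extend_eq he hp.2 w.2
        let w' : TangentSpace (I.prod I) p := (w1, w2)
        have hw' : w' ∈ tangentTo (I.prod I) P p :=
          (htan w').2 ((congrArg A (Prod.ext hw1 hw2)).trans hw)
        have h := (Ω.prodNeg_apply p v w').symm.trans (hvw w' hw')
        refine Eq.trans ?_ ((congrArg₂ (· - ·) (Ω.bilinInChart_mfderiv he hp.1 v.1 w1)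
          (Ω.bilinInChart_mfderiv he hp.2 v.2 w2)).trans h)
        exact congrArg₂ (fun a b : E => Ω.bilinInChart e (e.extend I p.1)
          (mfderiv I 𝓘(ℝ, E) (e.extend I) p.1 v.1) a - Ω.bilinInChart e (e.extend I p.2)
          (mfderiv I 𝓘(ℝ, E) (e.extend I) p.2 v.2) b) hw1.symm hw2.symm
  refine ⟨fun p hp => ?_, fun p hp => ?_⟩
  · obtain ⟨e', he', hpe', W', hW', h, -⟩ := main p hp
    exact ⟨e', he', hpe', W', hW', h⟩
  · obtain ⟨e', he', hpe', W', hW', h, h'⟩ := main p hp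
    exact h'

/-- A compact coisotropic submanifold `N` of codimension `k` has its diagonal embedding contained
in a symplectic submanifold of codimension `2 * k` of `M × M` that lies in `M × N`. -/
theorem exists_isSymplecticSubmanifold_diagonalOf_subset [T2Space M] (hΩ : IsSymplecticForm I Ω)
    {d k D : ℕ} (hN : IsCoisotropicSubmanifold I Ω d N) (hNc : IsCompact N)
    (hk : d + k = Module.finrank ℝ E) (hD : D + 2 * k = 2 * Module.finrank ℝ E) :
    ∃ P : Set (M × M), IsSymplecticSubmanifold (I.prod I) (Ω.prodNeg I) D P ∧
      P ⊆ Set.univ ×ˢ N ∧ diagonalOf N ⊆ P := by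
  obtain ⟨r, F, hF, hFN⟩ := exists_contMDiff_injective_mfderiv_of_isCompact I hNc
  let β := (isBoundedBilinearMap_inner (𝕜 := ℝ) (E := EuclideanSpace ℝ (Fin r))).toContinuousLinearMap
  have hβ : ∀ v, β v v = 0 → v = 0 := fun v hv => inner_self_eq_zero.1 hv
  let good : M × M → OpenPartialHomeomorph M H → Submodule ℝ E → (E →L[ℝ] (Fin k → ℝ)) → Prop :=
    fun p e W π => e ∈ IsManifold.maximalAtlas I ∞ M ∧
      (∀ q ∈ e.source, (q ∈ N ↔ e.extend I q ∈ W)) ∧ Function.Surjective π ∧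
      (∀ v, π v = 0 ↔ v ∈ W) ∧ p ∈ (e.prod e).source ∧
      (e.extend I p.1, e.extend I p.2) ∈ sliceRegion β (Ω.bilinInChart e) π
        (F ∘ (e.extend I).symm) (e.extend I).target
  refine ⟨{p ∈ orthoSlice I Ω N β F | ∃ e W π, good p e W π}, ?_, ?_, ?_⟩
  · refine isSymplecticSubmanifold_of_sliceRegion (β := β) (F := F) (Y := Fin k → ℝ) hΩ hN hF
      (by simpa using hD) ?_
    rintro p ⟨-, e, W, π, he, hW, hπ, hπW, hp, hpR⟩
    exact ⟨e, he, W, π, hW, hπ, hπW, hp, hpR, fun q hq hqR =>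
      ⟨fun h => h.1, fun h => ⟨h, e, W, π, he, hW, hπ, hπW, hq, hqR⟩⟩⟩
  · rintro p ⟨hp, -⟩
    exact ⟨trivial, hp.1⟩
  · rintro _ ⟨x, hx, rfl⟩
    refine ⟨diagonalOf_subset_orthoSlice ⟨x, hx, rfl⟩, ?_⟩
    obtain ⟨e, he, hxe, W, hWd, hW⟩ := hN.1 x hx
    obtain ⟨π, hπ, hπW⟩ := exists_continuousLinearMap_ker_eq W (k := k) (by rw [hWd, hk])
    have hu : e.extend I x ∈ (e.extend I).target :=
      (e.extend I).map_source (by rwa [e.extend_source])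
    refine ⟨e, W, π, he, hW, hπ, hπW, ⟨hxe, hxe⟩, diag_mem_sliceRegion hβ hπ
      e.isOpen_extend_target (hΩ.contDiffOn_bilinInChart he)
      (fun u hu => hΩ.isInvertible_bilinInChart he hu) (contDiffOn_comp_extend_symm he hF) hu ?_⟩
    refine (injective_iff_map_eq_zero _).2 fun a ha => ?_
    obtain ⟨v, hv⟩ := exists_mfderiv_extend_eq he hxe a
    have h0 : mfderiv I 𝓘(ℝ, EuclideanSpace ℝ (Fin r)) F x v = 0 :=
      (fderiv_comp_extend_symm he hF hxe v).symm.trans ((congrArg _ hv).trans ha)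
    have hv0 : v = 0 := hFN x hx (h0.trans (map_zero _).symm)
    rw [← hv, hv0]
    exact map_zero _

end Slice

end Sympl

end

theorem lemma4 (n k m d : ℕ) (hd : d + k = 2 * n) (hm : m + k = n)
    (M : Type*) [TopologicalSpace M] [T2Space M] [SecondCountableTopology M]
    [ChartedSpace (EuclideanSpace ℝ (Fin (2 * n))) M] [IsManifold (𝓡 (2 * n)) ∞ M]
    (Ω : Sympl.TwoForm (𝓡 (2 * n)) M) (hΩ : Sympl.IsSymplecticForm (𝓡 (2 * n)) Ω)
    (N : Set M) (hN : Sympl.IsCoisotropicSubmanifold (𝓡 (2 * n)) Ω d N) (hNc : IsCompact N) :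
    (∃ P : Set (M × M),
      Sympl.IsSymplecticSubmanifold ((𝓡 (2 * n)).prod (𝓡 (2 * n)))
        (Sympl.TwoForm.prodNeg (𝓡 (2 * n)) Ω) (2 * n + 2 * m) P ∧
      P ⊆ Set.univ ×ˢ N ∧ Sympl.diagonalOf N ⊆ P) ∧
    ∀ P : Set (M × M),
      Sympl.IsSymplecticSubmanifold ((𝓡 (2 * n)).prod (𝓡 (2 * n)))
        (Sympl.TwoForm.prodNeg (𝓡 (2 * n)) Ω) (2 * n + 2 * m) P →
      P ⊆ Set.univ ×ˢ N → Sympl.diagonalOf N ⊆ P →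
      Sympl.IsLagrangianSubmanifoldOf ((𝓡 (2 * n)).prod (𝓡 (2 * n)))
        (Sympl.TwoForm.prodNeg (𝓡 (2 * n)) Ω) (2 * n + 2 * m) P (Sympl.diagonalOf N) := by
  refine ⟨Sympl.exists_isSymplecticSubmanifold_diagonalOf_subset (k := k) hΩ hN hNc ?_ ?_,
    fun P hP _ hNP => Sympl.isLagrangianSubmanifoldOf_diagonalOf hN.1 (by omega) Ω hP hNP⟩
  · rw [finrank_euclideanSpace_fin, hd]
  · rw [finrank_euclideanSpace_fin]
    omega
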